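/- Let $D\subset\mathbb{R}$ be a bounded domain and let $\mathcal{L}$ be a densely defined, linear, self-adjoint, positive operator on $L^2(D)$ with compact inverse. Let $(e_j)_{j\ge 1}$ be an orthonormal basis of $L^2(D)$ with $\mathcal{L}e_j=\lambda_j e_j$ and $0<\alpha<\lambda_1\le\lambda_2\le\dots$. Let $Q$ be a bounded, self-adjoint, positive semidefinite operator on $L^2(D)$ with $Qe_j=\mu_je_j$ for all $j$ and $\operatorname{Tr}Q=\sum_j\mu_j<\infty$. Let $T\ge 0$, and let $W$ be an $L^2(D)$-valued $Q$-Wiener process on $[0,T]$ with respect to a normal filtration $(\mathcal{F}_t)$ on a probability space $(\Omega,\mathcal{F},\mathbb{P})$; write $W(t)=\sum_j\sqrt{\mu_j}\,B_j(t)\,e_j$, where $B_j=\mu_j^{-1/2}\langle W,e_j\rangle$ (and $B_j:=0$ if $\mu_j=0$). Fix $s>0$ and a deterministic $y_0\in L^2(D)$. Then the Ornstein–Uhlenbeck processes $$y_j(s,t)=\langle y_0,e_j\rangle e^{-\lambda_j^s t}+\sqrt{\mu_j}\int_0^t e^{-\lambda_j^s(t-\tau)}\,dB_j(\tau),\qquad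 t\in[0,T],\ j\ge 1,$$ exist (the stochastic integral being the $L^2(\Omega)$-limit of the integrals of step functions approximating the deterministic integrand in $L^2(0,t)$). For every choice of versions of the $y_j$, for each $t\in[0,T]$ the partial sums of the series $\sum_{j}y_j(s,t)e_j$ belong to $L^2(\Omega,L^2(D))$ and the series converges in $L^2(\Omega,L^2(D))$. Its limit has a version $y(s)(\cdot,t)$, $t\in[0,T]$, which is an $(\mathcal{F}_t)$-adapted $L^2(D)$-valued process, and $$\sup_{t\in[0,T]}\mathbb{E}\,\|y(s)(\cdot,t)\|_{L^2(D)}^2\le\|y_0\|_{L^2(D)}^2+\frac{\operatorname{Tr}Q}{2\alpha^s}.$$ -/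

import Mathlib

open MeasureTheory ProbabilityTheory Filter Topology Set
open scoped NNReal ENNReal RealInnerProductSpace

namespace FracSPDE

section Operators

variable {H : Type*} [NormedAddCommGroup H] [InnerProductSpace ℝ H] [CompleteSpace H]

/-- A densely defined, linear, self-adjoint, positive (possibly unbounded) operator on `H`
with compact inverse. -/
structure IsPositiveWithCompactInverse (A : H →ₗ.[ℝ] H) : Prop where
  dense_domain : Dense (A.domain : Set H)
  self_adjoint : IsSelfAdjoint A
  nonneg : ∀ v : A.domain, 0 ≤ ⟪A v, (v : H)⟫
  compact_inverse : ∃ K : H →L[ℝ] H, IsCompactOperator K ∧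
    (∀ v : H, ∃ hv : K v ∈ A.domain, A ⟨K v, hv⟩ = v) ∧
    (∀ v : A.domain, K (A v) = v)

/-- `φ` is an eigenvector of the unbounded operator `A` (in its domain), or zero,
with `A φ = c φ`. -/
def IsEigenpair (A : H →ₗ.[ℝ] H) (c : ℝ) (φ : H) : Prop :=
  ∃ hφ : φ ∈ A.domain, A ⟨φ, hφ⟩ = c • φ

/-- The trace `Tr Q = ∑ⱼ ⟨eⱼ, Q eⱼ⟩` of a bounded operator, computed in the
orthonormal basis `e`. -/
noncomputable def opTrace (e : HilbertBasis ℕ ℝ H) (Q : H →L[ℝ] H) : ℝ :=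
  ∑' j, ⟪e j, Q (e j)⟫

end Operators

section Noise

variable {Ω : Type*} {m : MeasurableSpace Ω}

/-- Normality of a filtration on `[0, T]`: `𝓕 0` contains all null events, and
`𝓕` is right-continuous. Time is indexed by `ℝ≥0`; only times in `[0, T]` matter. -/
structure IsNormalFiltration (𝓕 : Filtration ℝ≥0 m) (P : Measure Ω) (T : ℝ≥0) : Prop where
  null_mem : ∀ A : Set Ω, MeasurableSet A → P A = 0 → MeasurableSet[𝓕 0] A
  right_cont : ∀ t, t < T → (⨅ r > t, 𝓕 r) ≤ 𝓕 t

variable {H : Type*} [NormedAddCommGroup H] [InnerProductSpace ℝ H] [CompleteSpace H]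

/-- `W` is an `H`-valued `Q`-Wiener process on `[0, T]` with respect to the filtration `𝓕`:
it starts at `0`, has continuous paths, is adapted, its increment over `[r, t]` is
independent of `𝓕 r` and is Gaussian with mean zero and covariance operator `(t - r) Q`
(that is, each `⟨h, W t - W r⟩` has law `N(0, (t - r)⟨h, Q h⟩)`). -/
structure IsQWienerProcess (𝓕 : Filtration ℝ≥0 m) (P : Measure Ω) (T : ℝ≥0)
    (Q : H →L[ℝ] H) (W : ℝ≥0 → Ω → H) : Prop where
  zero : ∀ᵐ ω ∂P, W 0 ω = 0
  continuous_paths : ∀ᵐ ω ∂P, ContinuousOn (fun t => W t ω) (Iic T)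
  adapted : ∀ t, t ≤ T → StronglyMeasurable[𝓕 t] (W t)
  indep_increments : ∀ r t, r ≤ t → t ≤ T →
    Indep (MeasurableSpace.comap (fun ω => W t ω - W r ω) (borel H)) (𝓕 r) P
  gaussian_increments : ∀ r t, r ≤ t → t ≤ T → ∀ h : H,
    HasLaw (fun ω => ⟪h, W t ω - W r ω⟫)
      (gaussianReal 0 (Real.toNNReal (((t : ℝ) - r) * ⟪h, Q h⟫))) P

/-- The real Brownian motion `Bⱼ = μⱼ^{-1/2} ⟨eⱼ, W⟩` driving the `j`-th mode, so that
`W(t) = ∑ⱼ √μⱼ Bⱼ(t) eⱼ`. If `μⱼ = 0`, the mode `⟨eⱼ, W⟩` vanishes and `Bⱼ`, which occurs only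
multiplied by `√μⱼ`, is `0` by convention. -/
noncomputable def modeBM (e : HilbertBasis ℕ ℝ H) (μ : ℕ → ℝ) (W : ℝ≥0 → Ω → H)
    (j : ℕ) (t : ℝ≥0) (ω : Ω) : ℝ :=
  (√(μ j))⁻¹ * ⟪e j, W t ω⟫

end Noise

section WienerIntegral

/-- A deterministic step function `∑ᵢ cᵢ 1_{(aᵢ, bᵢ]}` on `[0, ∞)`. -/
structure StepData where
  n : ℕ
  c : Fin n → ℝ
  a : Fin n → ℝ≥0
  b : Fin n → ℝ≥0
  le : ∀ i, a i ≤ b i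

/-- The function `τ ↦ ∑ᵢ cᵢ 1_{(aᵢ, bᵢ]}(τ)`. -/
noncomputable def StepData.toFun (φ : StepData) (τ : ℝ) : ℝ :=
  ∑ i, (Ioc (φ.a i : ℝ) (φ.b i)).indicator (fun _ => φ.c i) τ

variable {Ω : Type*} {m : MeasurableSpace Ω}

/-- The stochastic integral `∑ᵢ cᵢ (B(bᵢ) - B(aᵢ))` of a step function. -/
noncomputable def StepData.integral (φ : StepData) (B : ℝ≥0 → Ω → ℝ) (ω : Ω) : ℝ :=
  ∑ i, φ.c i * (B (φ.b i) ω - B (φ.a i) ω)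

/-- `X = ∫₀ᵗ f(τ) dB(τ)`, the Itô integral of the deterministic integrand `f`: the limit in
`L²(Ω)` of the stochastic integrals of step functions on `(0, t]` that converge to `f` in
`L²(0, t)`. -/
def IsItoIntegral (P : Measure Ω) (B : ℝ≥0 → Ω → ℝ) (f : ℝ → ℝ) (t : ℝ≥0)
    (X : Ω → ℝ) : Prop :=
  MemLp X 2 P ∧ ∃ φ : ℕ → StepData,
    (∀ n i, (φ n).b i ≤ t) ∧
    Tendsto (fun n => eLpNorm (fun τ => (φ n).toFun τ - f τ) 2
      (volume.restrict (Ioc (0 : ℝ) t))) atTop (𝓝 0) ∧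
    Tendsto (fun n => eLpNorm (fun ω => (φ n).integral B ω - X ω) 2 P) atTop (𝓝 0)

/-- `y` is (a version of) the Ornstein–Uhlenbeck process
`y(t) = c e^{-κ t} + σ ∫₀ᵗ e^{-κ (t - τ)} dB(τ)`, `t ∈ [0, T]`, with initial value `c`,
drift rate `κ` and noise intensity `σ`. -/
def IsOrnsteinUhlenbeck (P : Measure Ω) (T : ℝ≥0) (B : ℝ≥0 → Ω → ℝ) (c κ σ : ℝ)
    (y : ℝ≥0 → Ω → ℝ) : Prop :=
  ∀ t, t ≤ T → ∃ X : Ω → ℝ,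
    IsItoIntegral P B (fun τ => Real.exp (-κ * ((t : ℝ) - τ))) t X ∧
    ∀ᵐ ω ∂P, y t ω = c * Real.exp (-κ * t) + σ * X ω

end WienerIntegral

end FracSPDE

open FracSPDE

/-! Each mode is a scalar problem, and the bound is Parseval in `L²(Ω, H)`. For a deterministic
integrand only the second-order structure of the driving noise matters: mean zero and covariance `ε
min(r, t)` (`IsBrownianL2`) give the Itô isometry, first on step functions and then in the limit.
Hence `E yⱼ(t)² ≤ ⟨eⱼ, y₀⟩² + μⱼ / (2 λⱼˢ)`, and `λⱼ > α` makes this summable with sum at most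
`‖y₀‖² + Tr Q / (2 αˢ)`.

The terms `yⱼ eⱼ` are orthogonal in `L²(Ω, H)` because the `eⱼ` are, whatever the correlations
between coefficients, so `exists_tendsto_series` yields convergence and the bound together.
Adaptedness survives both limits (step integrals, partial sums) because classes with a measurable
representative are closed in `L²`. -/

namespace FracSPDE

/-! ### Norms and orthogonal series in `L²` -/

section L2

variable {Ω : Type*} {m : MeasurableSpace Ω} {P : Measure Ω}
  {H : Type*} [NormedAddCommGroup H] [InnerProductSpace ℝ H]

lemma inner_toLp {f g : Ω → H} (hf : MemLp f 2 P) (hg : MemLp g 2 P) :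
    ⟪hf.toLp f, hg.toLp g⟫ = ∫ ω, ⟪f ω, g ω⟫ ∂P := by
  rw [L2.inner_def]
  refine integral_congr_ae ?_
  filter_upwards [hf.coeFn_toLp, hg.coeFn_toLp] with ω h1 h2
  rw [h1, h2]

lemma norm_toLp_sq {f : Ω → H} (hf : MemLp f 2 P) :
    ‖hf.toLp f‖ ^ 2 = ∫ ω, ‖f ω‖ ^ 2 ∂P := by
  rw [← real_inner_self_eq_norm_sq, inner_toLp]
  simp_rw [real_inner_self_eq_norm_sq]

lemma norm_toLp_sq_real {f : Ω → ℝ} (hf : MemLp f 2 P) :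
    ‖hf.toLp f‖ ^ 2 = ∫ ω, f ω ^ 2 ∂P := by
  rw [norm_toLp_sq]
  simp

lemma integral_norm_sq_of_ae_eq_Lp (Z : Lp H 2 P) {Y : Ω → H} (h : Z =ᵐ[P] Y) :
    ∫ ω, ‖Y ω‖ ^ 2 ∂P = ‖Z‖ ^ 2 := by
  have hY : MemLp Y 2 P := (Lp.memLp Z).ae_eq h
  have h2 : hY.toLp = Z := Lp.ext (hY.coeFn_toLp.trans h.symm)
  rw [← norm_toLp_sq hY, h2]

/-- In a Hilbert space, an orthogonal series with square-summable norms is summable, and the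
squared norm of each partial sum is the sum of the squared norms. -/
lemma orthogonal_summable {G : Type*} [NormedAddCommGroup G] [InnerProductSpace ℝ G]
    [CompleteSpace G] {u : ℕ → G} (hu : Pairwise fun i j => ⟪u i, u j⟫ = 0)
    (hs : Summable fun i => ‖u i‖ ^ 2) :
    Summable u ∧ ∀ s : Finset ℕ, ‖∑ i ∈ s, u i‖ ^ 2 = ∑ i ∈ s, ‖u i‖ ^ 2 := by
  -- Passing to the lines spanned by the `u i` avoids normalising, which would fail where `u i = 0`.
  have hV : OrthogonalFamily ℝ (fun i => (ℝ ∙ u i)) fun i => (ℝ ∙ u i).subtypeₗᵢ := by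
    rintro i j hij ⟨v, hv⟩ ⟨w, hw⟩
    obtain ⟨a, rfl⟩ := Submodule.mem_span_singleton.1 hv
    obtain ⟨b, rfl⟩ := Submodule.mem_span_singleton.1 hw
    simp [inner_smul_left, inner_smul_right, hu hij]
  let f : ∀ i, (ℝ ∙ u i) := fun i => ⟨u i, Submodule.mem_span_singleton_self _⟩
  exact ⟨(hV.summable_iff_norm_sq_summable f).2 hs, fun s => hV.norm_sum f s⟩

end L2

/-! ### Step functions, their Itô isometry and uniform approximation -/

section StepFunctions

/-- The overlap length `max (min b b' - max a a') 0` is written as an alternating sum of minima so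
that it matches the four covariances in the expanded product of two Brownian increments. -/
lemma integral_indicator_mul_indicator {t a b a' b' : ℝ} (ha : 0 ≤ a) (hab : a ≤ b) (hb : b ≤ t)
    (hab' : a' ≤ b') (c c' : ℝ) :
    ∫ τ in Ioc 0 t, (Ioc a b).indicator (fun _ => c) τ * (Ioc a' b').indicator (fun _ => c') τ
      = c * c' * (min b b' - min b a' - min a b' + min a a') := by
  have h : ∀ τ, (Ioc a b).indicator (fun _ => c) τ * (Ioc a' b').indicator (fun _ => c') τ
      = (Ioc (max a a') (min b b')).indicator (fun _ => c * c') τ := by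
    intro τ
    rw [← Ioc_inter_Ioc, inter_indicator_mul]
  simp_rw [h]
  rw [setIntegral_indicator measurableSet_Ioc, setIntegral_const,
    inter_eq_self_of_subset_right (Ioc_subset_Ioc (ha.trans (le_max_left _ _))
      ((min_le_left _ _).trans hb)), measureReal_def, Real.volume_Ioc, ENNReal.toReal_ofReal',
    smul_eq_mul, mul_comm]
  congr 1
  grind

lemma StepData.memLp_toFun (φ : StepData) (t : ℝ) :
    MemLp φ.toFun 2 (volume.restrict (Ioc 0 t)) := by
  have : φ.toFun = fun τ => ∑ i, (Ioc (φ.a i : ℝ) (φ.b i)).indicator (fun _ => φ.c i) τ := rfl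
  rw [this]
  exact memLp_finsetSum _ fun i _ => (memLp_const _).indicator measurableSet_Ioc

variable {Ω : Type*} {m : MeasurableSpace Ω}

/-- The second-order structure of a (possibly vanishing) multiple of a Brownian motion on
`[0, T]`: square integrable, centred, with covariance `ε min(r, t)`. -/
structure IsBrownianL2 (P : Measure Ω) (T : ℝ≥0) (ε : ℝ) (B : ℝ≥0 → Ω → ℝ) : Prop where
  memLp : ∀ t ≤ T, MemLp (B t) 2 P
  mean : ∀ t ≤ T, ∫ ω, B t ω ∂P = 0
  cov : ∀ r ≤ T, ∀ t ≤ T, ∫ ω, B r ω * B t ω ∂P = ε * min (r : ℝ) t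

variable {P : Measure Ω} {T t : ℝ≥0} {ε : ℝ} {B : ℝ≥0 → Ω → ℝ}

lemma IsBrownianL2.memLp_integral (hB : IsBrownianL2 P T ε B) {φ : StepData}
    (hφ : ∀ i, φ.b i ≤ T) : MemLp (φ.integral B) 2 P := by
  have : φ.integral B = fun ω => ∑ i, φ.c i * (B (φ.b i) ω - B (φ.a i) ω) := rfl
  rw [this]
  exact memLp_finsetSum _ fun i _ =>
    ((hB.memLp _ (hφ i)).sub (hB.memLp _ ((φ.le i).trans (hφ i)))).const_mul _

lemma IsBrownianL2.integral_integral [IsProbabilityMeasure P] (hB : IsBrownianL2 P T ε B) {φ : StepData}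
    (hφ : ∀ i, φ.b i ≤ T) : ∫ ω, φ.integral B ω ∂P = 0 := by
  have hi : ∀ t ≤ T, Integrable (B t) P := fun t ht => (hB.memLp t ht).integrable (by norm_num)
  have hinc : ∀ i, Integrable (fun ω => φ.c i * (B (φ.b i) ω - B (φ.a i) ω)) P := fun i =>
    ((hi _ (hφ i)).sub (hi _ ((φ.le i).trans (hφ i)))).const_mul _
  unfold StepData.integral
  rw [integral_finsetSum _ fun i _ => hinc i]
  refine Finset.sum_eq_zero fun i _ => ?_
  rw [integral_const_mul, integral_sub (hi _ (hφ i)) (hi _ ((φ.le i).trans (hφ i))),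
    hB.mean _ (hφ i), hB.mean _ ((φ.le i).trans (hφ i))]
  simp

/-- The Itô isometry for step functions, in polarised form. -/
lemma IsBrownianL2.integral_mul_integral (hB : IsBrownianL2 P T ε B) (htT : t ≤ T)
    {φ ψ : StepData} (hφ : ∀ i, φ.b i ≤ t) (hψ : ∀ i, ψ.b i ≤ t) :
    ∫ ω, φ.integral B ω * ψ.integral B ω ∂P
      = ε * ∫ τ in Ioc (0 : ℝ) t, φ.toFun τ * ψ.toFun τ := by
  have hm : ∀ r ≤ t, MemLp (B r) 2 P := fun r hr => hB.memLp r (hr.trans htT)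
  have hinc : ∀ (χ : StepData), (∀ i, χ.b i ≤ t) → ∀ i,
      MemLp (fun ω => χ.c i * (B (χ.b i) ω - B (χ.a i) ω)) 2 P := fun χ hχ i =>
    ((hm _ (hχ i)).sub (hm _ ((χ.le i).trans (hχ i)))).const_mul _
  have hind : ∀ (χ : StepData) (i : Fin χ.n),
      MemLp ((Ioc (χ.a i : ℝ) (χ.b i)).indicator fun _ => χ.c i) 2
        (volume.restrict (Ioc (0 : ℝ) t)) := fun χ i =>
    (memLp_const _).indicator measurableSet_Ioc
  have hinc2 : ∀ i k, Integrable (fun ω => φ.c i * (B (φ.b i) ω - B (φ.a i) ω) *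
      (ψ.c k * (B (ψ.b k) ω - B (ψ.a k) ω))) P := fun i k =>
    (hinc φ hφ i).integrable_mul (hinc ψ hψ k)
  have hind2 : ∀ i k, Integrable (fun τ => (Ioc (φ.a i : ℝ) (φ.b i)).indicator (fun _ => φ.c i) τ *
      (Ioc (ψ.a k : ℝ) (ψ.b k)).indicator (fun _ => ψ.c k) τ)
      (volume.restrict (Ioc (0 : ℝ) t)) := fun i k => (hind φ i).integrable_mul (hind ψ k)
  simp only [StepData.integral, StepData.toFun, Finset.sum_mul_sum]
  rw [integral_finsetSum _ fun i _ => integrable_finsetSum _ fun k _ => hinc2 i k,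
    integral_finsetSum _ fun i _ => integrable_finsetSum _ fun k _ => hind2 i k, Finset.mul_sum]
  refine Finset.sum_congr rfl fun i _ => ?_
  rw [integral_finsetSum _ fun k _ => hinc2 i k, integral_finsetSum _ fun k _ => hind2 i k,
    Finset.mul_sum]
  refine Finset.sum_congr rfl fun k _ => ?_
  have hb := hφ i
  have ha := (φ.le i).trans (hφ i)
  have hb' := hψ k
  have ha' := (ψ.le k).trans (hψ k)
  rw [integral_indicator_mul_indicator (φ.a i).coe_nonneg (NNReal.coe_le_coe.2 (φ.le i))
    (NNReal.coe_le_coe.2 hb) (NNReal.coe_le_coe.2 (ψ.le k))]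
  have hmul : ∀ r ≤ t, ∀ s ≤ t, Integrable (fun ω => B r ω * B s ω) P := fun r hr s hs =>
    (hm r hr).integrable_mul (hm s hs)
  have h : ∀ ω, φ.c i * (B (φ.b i) ω - B (φ.a i) ω) * (ψ.c k * (B (ψ.b k) ω - B (ψ.a k) ω))
      = φ.c i * ψ.c k * ((B (φ.b i) ω * B (ψ.b k) ω - B (φ.b i) ω * B (ψ.a k) ω)
        - (B (φ.a i) ω * B (ψ.b k) ω - B (φ.a i) ω * B (ψ.a k) ω)) := fun ω => by ring
  simp_rw [h]
  have hsub : ∀ r ≤ t, Integrable (fun ω => B r ω * B (ψ.b k) ω - B r ω * B (ψ.a k) ω) P :=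
    fun r hr => (hmul r hr _ hb').sub (hmul r hr _ ha')
  rw [integral_const_mul, integral_sub (hsub _ hb) (hsub _ ha),
    integral_sub (hmul _ hb _ hb') (hmul _ hb _ ha'),
    integral_sub (hmul _ ha _ hb') (hmul _ ha _ ha'),
    hB.cov _ (hb.trans htT) _ (hb'.trans htT), hB.cov _ (hb.trans htT) _ (ha'.trans htT),
    hB.cov _ (ha.trans htT) _ (hb'.trans htT), hB.cov _ (ha.trans htT) _ (ha'.trans htT)]
  ring

lemma IsBrownianL2.norm_toLp_integral_sq (hB : IsBrownianL2 P T ε B) (htT : t ≤ T)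
    {φ : StepData} (hφ : ∀ i, φ.b i ≤ t) (h : MemLp (φ.integral B) 2 P) :
    ‖h.toLp‖ ^ 2 = ε * ‖(φ.memLp_toFun t).toLp‖ ^ 2 := by
  rw [norm_toLp_sq_real, norm_toLp_sq_real]
  simp_rw [sq]
  exact hB.integral_mul_integral htT hφ hφ

/-- `StepData` has no subtraction, so the isometry for differences is assembled from the polarised
one by expanding squares. -/
lemma IsBrownianL2.norm_sub_toLp_integral_sq (hB : IsBrownianL2 P T ε B) (htT : t ≤ T)
    {φ ψ : StepData} (hφ : ∀ i, φ.b i ≤ t) (hψ : ∀ i, ψ.b i ≤ t)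
    (h : MemLp (φ.integral B) 2 P) (h' : MemLp (ψ.integral B) 2 P) :
    ‖h.toLp - h'.toLp‖ ^ 2
      = ε * ‖(φ.memLp_toFun t).toLp - (ψ.memLp_toFun t).toLp‖ ^ 2 := by
  have key : ⟪h.toLp, h'.toLp⟫ = ε * ⟪(φ.memLp_toFun t).toLp, (ψ.memLp_toFun t).toLp⟫ := by
    rw [inner_toLp, inner_toLp]
    simpa using hB.integral_mul_integral htT hψ hφ
  rw [norm_sub_sq_real, norm_sub_sq_real, hB.norm_toLp_integral_sq htT hφ,
    hB.norm_toLp_integral_sq htT hψ, key]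
  ring

/-- The uniform step approximation of `f` on `(0, t]` from right endpoints. -/
noncomputable def uniformStep (f : ℝ → ℝ) (t : ℝ≥0) (n : ℕ) : StepData where
  n := n + 1
  c i := f (t * (i + 1) / (n + 1))
  a i := t * i / (n + 1)
  b i := t * (i + 1) / (n + 1)
  le i := by gcongr; simp

lemma uniformStep_b_le (f : ℝ → ℝ) (t : ℝ≥0) (n : ℕ) (i : Fin (uniformStep f t n).n) :
    (uniformStep f t n).b i ≤ t := by
  have hi : (i : ℕ) + 1 ≤ n + 1 := i.2
  have hi' : ((i : ℕ) : ℝ≥0) + 1 ≤ n + 1 := mod_cast hi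
  change t * ((i : ℕ) + 1) / (n + 1) ≤ t
  rw [mul_div_assoc]
  exact mul_le_of_le_one_right' (div_le_one_of_le₀ hi' (by positivity))

lemma abs_uniformStep_sub_le {f : ℝ → ℝ} {t : ℝ≥0} {K : ℝ}
    (hf : ∀ x ∈ Icc (0 : ℝ) t, ∀ y ∈ Icc (0 : ℝ) t, |f x - f y| ≤ K * |x - y|) (hK : 0 ≤ K)
    (n : ℕ) {τ : ℝ} (hτ : τ ∈ Ioc (0 : ℝ) t) :
    |(uniformStep f t n).toFun τ - f τ| ≤ K * (t / (n + 1)) := by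
  have ht : (0 : ℝ) < t := hτ.1.trans_le hτ.2
  have hn : (0 : ℝ) < n + 1 := by positivity
  have hx : 0 < τ * (n + 1) / t := by have := hτ.1; positivity
  have hxn : τ * (n + 1) / t ≤ n + 1 := by
    rw [div_le_iff₀ ht]; nlinarith [hτ.2]
  -- The cells are open on the left and closed on the right, so the index of the one containing `τ`
  -- is a ceiling minus one.
  obtain ⟨k, hk⟩ : ∃ k : ℕ, ⌈τ * (n + 1) / t⌉₊ = k + 1 :=
    Nat.exists_eq_succ_of_ne_zero (Nat.ceil_pos.2 hx).ne'
  have hkn : k < n + 1 := by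
    have : ⌈τ * (n + 1) / t⌉₊ ≤ n + 1 := Nat.ceil_le.2 (by exact_mod_cast hxn)
    omega
  have hmem : ∀ i : ℕ, τ ∈ Ioc (t * i / (n + 1) : ℝ) (t * (i + 1) / (n + 1)) ↔ i = k := by
    intro i
    rw [mem_Ioc, div_lt_iff₀ hn, le_div_iff₀ hn, mul_comm (t : ℝ), ← lt_div_iff₀ ht,
      mul_comm (t : ℝ), ← div_le_iff₀ ht, ← Nat.lt_ceil, hk]
    have : (τ * (n + 1) / t ≤ (i : ℝ) + 1) ↔ k + 1 ≤ i + 1 := by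
      rw [← hk, Nat.ceil_le]; push_cast; rfl
    rw [this]; omega
  have hval : (uniformStep f t n).toFun τ = f (t * (k + 1) / (n + 1)) := by
    change ∑ i : Fin (n + 1), (Ioc ((t * (i : ℕ) / (n + 1) : ℝ≥0) : ℝ)
      ((t * ((i : ℕ) + 1) / (n + 1) : ℝ≥0) : ℝ)).indicator
      (fun _ => f (t * ((i : ℕ) + 1) / (n + 1))) τ = _
    rw [Finset.sum_eq_single ⟨k, hkn⟩]
    · rw [indicator_of_mem]
      push_cast
      exact (hmem k).2 rfl
    · intro i _ hi
      rw [indicator_of_notMem]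
      push_cast
      rw [hmem]
      exact fun h => hi (Fin.ext h)
    · simp
  have h := (hmem k).2 rfl
  have hk1 : ((k : ℝ) + 1) ≤ n + 1 := mod_cast hkn
  have hle : (t : ℝ) * (k + 1) / (n + 1) ≤ t := by
    rw [div_le_iff₀ hn]; gcongr
  rw [hval]
  refine (hf _ ⟨by positivity, hle⟩ _ ⟨hτ.1.le, hτ.2⟩).trans ?_
  gcongr
  rw [abs_of_nonneg (sub_nonneg.2 h.2), sub_le_iff_le_add]
  have : (t : ℝ) * (k + 1) / (n + 1) = t / (n + 1) + t * k / (n + 1) := by ring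
  linarith [h.1]

lemma tendsto_uniformStep {f : ℝ → ℝ} {t : ℝ≥0} {K : ℝ}
    (hf : ∀ x ∈ Icc (0 : ℝ) t, ∀ y ∈ Icc (0 : ℝ) t, |f x - f y| ≤ K * |x - y|) (hK : 0 ≤ K) :
    Tendsto (fun n => eLpNorm (fun τ => (uniformStep f t n).toFun τ - f τ) 2
      (volume.restrict (Ioc (0 : ℝ) t))) atTop (𝓝 0) := by
  have hlim : Tendsto (fun n : ℕ => (volume.restrict (Ioc (0 : ℝ) t)) univ ^
      (2 : ℝ≥0∞).toReal⁻¹ * ENNReal.ofReal (K * (t / (n + 1)))) atTop (𝓝 0) := by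
    have h1 : Tendsto (fun n : ℕ => K * ((t : ℝ) / (n + 1))) atTop (𝓝 0) := by
      have := (tendsto_one_div_add_atTop_nhds_zero_nat (𝕜 := ℝ)).const_mul (K * t)
      rw [mul_zero] at this
      refine this.congr fun n => by ring
    have h2 := ENNReal.tendsto_ofReal h1
    rw [ENNReal.ofReal_zero] at h2
    have h3 := ENNReal.Tendsto.const_mul (a := (volume.restrict (Ioc (0 : ℝ) t)) univ ^
      (2 : ℝ≥0∞).toReal⁻¹) h2 (Or.inr (by
        refine ENNReal.rpow_ne_top_of_nonneg (by positivity) (measure_ne_top _ _)))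
    rwa [mul_zero] at h3
  refine tendsto_of_tendsto_of_tendsto_of_le_of_le tendsto_const_nhds hlim
    (fun _ => zero_le) fun n => eLpNorm_le_of_ae_bound ?_
  filter_upwards [ae_restrict_mem measurableSet_Ioc] with τ hτ
  exact abs_uniformStep_sub_le hf hK n hτ

end StepFunctions

/-! ### The Itô integral of a deterministic integrand -/

section ItoIntegral

variable {Ω : Type*} {m : MeasurableSpace Ω} {P : Measure Ω}
  {T t : ℝ≥0} {ε : ℝ} {B : ℝ≥0 → Ω → ℝ} {f : ℝ → ℝ} {X : Ω → ℝ}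

/-- Integration of step functions scales `L²` distances by `√ε`, so it preserves Cauchy sequences,
and `L²(Ω)` is complete. -/
lemma IsBrownianL2.exists_isItoIntegral (hB : IsBrownianL2 P T ε B) (htT : t ≤ T)
    (hf : MemLp f 2 (volume.restrict (Ioc (0 : ℝ) t))) {φ : ℕ → StepData}
    (hφ : ∀ n i, (φ n).b i ≤ t)
    (hlim : Tendsto (fun n => eLpNorm (fun τ => (φ n).toFun τ - f τ) 2
      (volume.restrict (Ioc (0 : ℝ) t))) atTop (𝓝 0)) :
    ∃ X, IsItoIntegral P B f t X := by
  have hI : ∀ n, MemLp ((φ n).integral B) 2 P := fun n =>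
    hB.memLp_integral fun i => (hφ n i).trans htT
  have h1 := ((Lp.tendsto_Lp_iff_tendsto_eLpNorm'' (fun n => (φ n).toFun)
    (fun n => (φ n).memLp_toFun t) f hf).2 hlim).cauchySeq
  have h2 : CauchySeq fun n => (hI n).toLp := by
    rw [cauchySeq_iff_tendsto_dist_atTop_0] at h1 ⊢
    have h3 := h1.const_mul (√ε)
    rw [mul_zero] at h3
    refine h3.congr fun p => ?_
    -- `Real.sqrt_mul'` asks only that the second factor be nonnegative, so no sign of `ε` is
    -- needed.
    rw [dist_eq_norm, dist_eq_norm, ← Real.sqrt_sq (norm_nonneg ((hI p.1).toLp - _)),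
      hB.norm_sub_toLp_integral_sq htT (hφ p.1) (hφ p.2), Real.sqrt_mul' _ (sq_nonneg _),
      Real.sqrt_sq (norm_nonneg _)]
  obtain ⟨Z, hZ⟩ := cauchySeq_tendsto_of_complete h2
  refine ⟨Z, Lp.memLp Z, φ, hφ, hlim, ?_⟩
  refine (Lp.tendsto_Lp_iff_tendsto_eLpNorm'' (fun n => (φ n).integral B) hI Z (Lp.memLp Z)).1 ?_
  rwa [Lp.toLp_coeFn]

/-- The Itô integral of a deterministic integrand is centred and satisfies the Itô isometry. -/
lemma IsBrownianL2.isItoIntegral_moments [IsProbabilityMeasure P]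
    (hB : IsBrownianL2 P T ε B) (htT : t ≤ T)
    (hf : MemLp f 2 (volume.restrict (Ioc (0 : ℝ) t))) (hX : IsItoIntegral P B f t X) :
    ∫ ω, X ω ∂P = 0 ∧ ∫ ω, X ω ^ 2 ∂P = ε * ∫ τ in Ioc (0 : ℝ) t, f τ ^ 2 := by
  obtain ⟨hXm, φ, hφ, hlim, hXlim⟩ := hX
  have hI : ∀ n, MemLp ((φ n).integral B) 2 P := fun n =>
    hB.memLp_integral fun i => (hφ n i).trans htT
  have h1 := (Lp.tendsto_Lp_iff_tendsto_eLpNorm'' (fun n => (φ n).toFun)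
    (fun n => (φ n).memLp_toFun t) f hf).2 hlim
  have h2 := (Lp.tendsto_Lp_iff_tendsto_eLpNorm'' (fun n => (φ n).integral B) hI X hXm).2 hXlim
  constructor
  -- The mean is the inner product with the constant `1`, hence continuous in `L²`.
  · have hone : MemLp (fun _ : Ω => (1 : ℝ)) 2 P := memLp_const 1
    have h3 : Tendsto (fun n => ⟪hone.toLp, (hI n).toLp⟫) atTop (𝓝 ⟪hone.toLp, hXm.toLp⟫) :=
      tendsto_const_nhds.inner h2
    simp only [inner_toLp] at h3
    have h4 : ∀ n, ∫ ω, ⟪(1 : ℝ), (φ n).integral B ω⟫ ∂P = 0 := fun n => by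
      simpa using hB.integral_integral fun i => (hφ n i).trans htT
    simp only [h4] at h3
    simpa using (tendsto_nhds_unique h3 tendsto_const_nhds)
  · rw [← norm_toLp_sq_real hXm, ← norm_toLp_sq_real hf]
    refine tendsto_nhds_unique (h2.norm.pow 2) ?_
    refine ((h1.norm.pow 2).const_mul ε).congr fun n => ?_
    rw [hB.norm_toLp_integral_sq htT (hφ n)]

lemma aestronglyMeasurable_of_tendsto_eLpNorm {H : Type*} [NormedAddCommGroup H]
    [CompleteSpace H] {m' : MeasurableSpace Ω} (hm : m' ≤ m) {u : ℕ → Ω → H} {Z : Ω → H}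
    (hu : ∀ n, MemLp (u n) 2 P) (hZ : MemLp Z 2 P)
    (hlim : Tendsto (fun n => eLpNorm (fun ω => u n ω - Z ω) 2 P) atTop (𝓝 0))
    (hmeas : ∀ n, AEStronglyMeasurable[m'] (u n) P) : AEStronglyMeasurable[m'] Z P := by
  have h := (Lp.tendsto_Lp_iff_tendsto_eLpNorm'' u hu Z hZ).2 hlim
  exact ((isClosed_aestronglyMeasurable hm).mem_of_tendsto h (Eventually.of_forall fun n =>
    (hmeas n).congr (hu n).coeFn_toLp.symm)).congr hZ.coeFn_toLp

lemma IsBrownianL2.aestronglyMeasurable_isItoIntegral (hB : IsBrownianL2 P T ε B) (htT : t ≤ T)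
    {m' : MeasurableSpace Ω} (hm : m' ≤ m) (hmeas : ∀ r ≤ t, StronglyMeasurable[m'] (B r))
    (hX : IsItoIntegral P B f t X) : AEStronglyMeasurable[m'] X P := by
  obtain ⟨hXm, φ, hφ, -, hXlim⟩ := hX
  refine aestronglyMeasurable_of_tendsto_eLpNorm hm (fun n =>
    hB.memLp_integral fun i => (hφ n i).trans htT) hXm hXlim fun n => ?_
  have : (φ n).integral B = fun ω =>
    ∑ i, (φ n).c i * (B ((φ n).b i) ω - B ((φ n).a i) ω) := rfl
  rw [this]
  refine (Finset.stronglyMeasurable_fun_sum _ fun i _ => ?_).aestronglyMeasurable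
  exact ((hmeas _ (hφ n i)).sub (hmeas _ (((φ n).le i).trans (hφ n i)))).const_mul _

end ItoIntegral

/-! ### Scalar Ornstein–Uhlenbeck processes -/

section OrnsteinUhlenbeck

/-- For `y ≤ x` the difference is `exp (-κ (t - x)) * (1 - exp (-κ (x - y)))`, with first factor at
most `1` and second at most `κ (x - y)`. This is the Lipschitz input for `tendsto_uniformStep`. -/
lemma abs_exp_sub_exp_le {κ : ℝ} (hκ : 0 ≤ κ) {t x y : ℝ} (hx : x ≤ t) (hy : y ≤ t) :
    |Real.exp (-κ * (t - x)) - Real.exp (-κ * (t - y))| ≤ κ * |x - y| := by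
  wlog hxy : y ≤ x generalizing x y
  · rw [abs_sub_comm, abs_sub_comm x]
    exact this hy hx (le_of_not_ge hxy)
  have h1 : Real.exp (-κ * (t - x)) ≤ 1 := Real.exp_le_one_iff.2 (by nlinarith)
  have h2 : Real.exp (-κ * (t - y)) = Real.exp (-κ * (t - x)) * Real.exp (-κ * (x - y)) := by
    rw [← Real.exp_add]; ring_nf
  have h3 : Real.exp (-κ * (x - y)) ≤ 1 := Real.exp_le_one_iff.2 (by nlinarith)
  have h4 := Real.add_one_le_exp (-κ * (x - y))
  have h5 := Real.exp_pos (-κ * (t - x))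
  rw [abs_of_nonneg (sub_nonneg.2 hxy), abs_of_nonneg (by rw [h2]; nlinarith), h2]
  nlinarith

lemma memLp_exp (κ t : ℝ) :
    MemLp (fun τ => Real.exp (-κ * (t - τ))) 2 (volume.restrict (Ioc (0 : ℝ) t)) := by
  refine (memLp_two_iff_integrable_sq (by fun_prop)).2 ?_
  exact Continuous.integrableOn_Ioc (by fun_prop)

lemma setIntegral_exp_sq_le {κ : ℝ} (hκ : 0 < κ) {t : ℝ} (ht : 0 ≤ t) :
    ∫ τ in Ioc (0 : ℝ) t, Real.exp (-κ * (t - τ)) ^ 2 ≤ 1 / (2 * κ) := by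
  have hd : ∀ τ ∈ uIcc 0 t, HasDerivAt (fun τ => Real.exp (-κ * (t - τ)) ^ 2 / (2 * κ))
      (Real.exp (-κ * (t - τ)) ^ 2) τ := by
    intro τ _
    have h := (((((hasDerivAt_id τ).const_sub t).const_mul (-κ)).exp).pow 2).div_const (2 * κ)
    refine h.congr_deriv ?_
    simp only [id, Nat.cast_ofNat, Nat.add_one_sub_one, pow_one]
    field_simp
  rw [← intervalIntegral.integral_of_le ht, intervalIntegral.integral_eq_sub_of_hasDerivAt hd
    (by apply Continuous.intervalIntegrable; fun_prop)]
  -- Dropping the contribution of the lower endpoint makes the bound uniform in `t`.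
  have : (0 : ℝ) ≤ Real.exp (-κ * (t - 0)) ^ 2 / (2 * κ) := by positivity
  simp only [sub_self, mul_zero, Real.exp_zero, one_pow]
  linarith

variable {Ω : Type*} {m : MeasurableSpace Ω} {P : Measure Ω}
  {T : ℝ≥0} {ε : ℝ} {B : ℝ≥0 → Ω → ℝ} {c κ σ : ℝ}

lemma IsBrownianL2.exists_isOrnsteinUhlenbeck (hB : IsBrownianL2 P T ε B) (hκ : 0 ≤ κ) :
    ∃ y, IsOrnsteinUhlenbeck P T B c κ σ y := by
  have h : ∀ t : ℝ≥0, t ≤ T → ∃ X,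
      IsItoIntegral P B (fun τ => Real.exp (-κ * ((t : ℝ) - τ))) t X := fun t ht =>
    hB.exists_isItoIntegral ht (memLp_exp κ t) (uniformStep_b_le _ t)
      (tendsto_uniformStep (fun x hx y hy => abs_exp_sub_exp_le hκ hx.2 hy.2) hκ)
  choose! X hX using h
  exact ⟨fun t ω => c * Real.exp (-κ * t) + σ * X t ω, fun t ht =>
    ⟨X t, hX t ht, Eventually.of_forall fun _ => rfl⟩⟩

lemma memLp_const_add_const_mul [IsFiniteMeasure P] {X : Ω → ℝ} (hX : MemLp X 2 P) (a b : ℝ) :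
    MemLp (fun ω => a + b * X ω) 2 P :=
  (memLp_const a).add (hX.const_mul b)

lemma integral_const_add_const_mul_sq [IsProbabilityMeasure P] {X : Ω → ℝ} (hX : MemLp X 2 P)
    (h0 : ∫ ω, X ω ∂P = 0) (a b : ℝ) :
    ∫ ω, (a + b * X ω) ^ 2 ∂P = a ^ 2 + b ^ 2 * ∫ ω, X ω ^ 2 ∂P := by
  have hi1 : Integrable X P := hX.integrable (by norm_num)
  have hi2 : Integrable (fun ω => X ω ^ 2) P := hX.integrable_sq
  have hadd : Integrable (fun ω => a ^ 2 + 2 * a * b * X ω) P :=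
    (integrable_const _).add (hi1.const_mul _)
  have e : ∀ ω, (a + b * X ω) ^ 2 = (a ^ 2 + 2 * a * b * X ω) + b ^ 2 * X ω ^ 2 :=
    fun ω => by ring
  simp_rw [e]
  rw [integral_add hadd (hi2.const_mul _), integral_add (integrable_const _) (hi1.const_mul _),
    integral_const_mul, integral_const_mul, h0]
  simp

/-- Square integrability and second moment of an Ornstein–Uhlenbeck process. -/
lemma IsBrownianL2.isOrnsteinUhlenbeck_moments [IsProbabilityMeasure P]
    (hB : IsBrownianL2 P T ε B) (hε : ε ≤ 1) (hκ : 0 < κ) {y : ℝ≥0 → Ω → ℝ}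
    (hy : IsOrnsteinUhlenbeck P T B c κ σ y) {t : ℝ≥0} (ht : t ≤ T) :
    MemLp (y t) 2 P ∧ ∫ ω, y t ω ^ 2 ∂P ≤ c ^ 2 + σ ^ 2 / (2 * κ) := by
  obtain ⟨X, hX, hyX⟩ := hy t ht
  obtain ⟨h0, h2⟩ := hB.isItoIntegral_moments ht (memLp_exp κ t) hX
  have hXm := hX.1
  have hmem : MemLp (fun ω => c * Real.exp (-κ * t) + σ * X ω) 2 P :=
    memLp_const_add_const_mul hXm _ σ
  refine ⟨hmem.ae_eq (hyX.mono fun _ h => h.symm), ?_⟩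
  have hint : ∫ ω, y t ω ^ 2 ∂P
      = (c * Real.exp (-κ * t)) ^ 2 + σ ^ 2 * ∫ ω, X ω ^ 2 ∂P := by
    rw [← integral_const_add_const_mul_sq hXm h0]
    exact integral_congr_ae (hyX.mono fun ω h => congrArg (· ^ 2) h)
  have hexp : Real.exp (-κ * t) ^ 2 ≤ 1 := by
    have : Real.exp (-κ * t) ≤ 1 :=
      Real.exp_le_one_iff.2 (by have := mul_nonneg hκ.le t.coe_nonneg; linarith)
    exact pow_le_one₀ (Real.exp_pos _).le this
  have hX2 : ∫ ω, X ω ^ 2 ∂P ≤ 1 / (2 * κ) := by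
    rw [h2]
    refine (mul_le_of_le_one_left ?_ hε).trans (setIntegral_exp_sq_le hκ t.coe_nonneg)
    exact integral_nonneg fun _ => sq_nonneg _
  rw [hint, mul_pow, div_eq_mul_one_div]
  exact add_le_add (mul_le_of_le_one_right (sq_nonneg c) hexp) (by gcongr)

lemma IsBrownianL2.aestronglyMeasurable_isOrnsteinUhlenbeck (hB : IsBrownianL2 P T ε B)
    {y : ℝ≥0 → Ω → ℝ} (hy : IsOrnsteinUhlenbeck P T B c κ σ y) {t : ℝ≥0} (ht : t ≤ T)
    {m' : MeasurableSpace Ω} (hm : m' ≤ m) (hmeas : ∀ r ≤ t, StronglyMeasurable[m'] (B r)) :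
    AEStronglyMeasurable[m'] (y t) P := by
  obtain ⟨X, hX, hyX⟩ := hy t ht
  have hXa := hB.aestronglyMeasurable_isItoIntegral ht hm hmeas hX
  refine ⟨fun ω => c * Real.exp (-κ * t) + σ * hXa.mk X ω,
    stronglyMeasurable_const.add (hXa.stronglyMeasurable_mk.const_mul σ), ?_⟩
  filter_upwards [hyX, hXa.ae_eq_mk] with ω h h'
  rw [h, h']

end OrnsteinUhlenbeck

/-! ### Second-order structure of the modes of `W` -/

section Modes

variable {Ω : Type*} {m : MeasurableSpace Ω} {P : Measure Ω}
  {H : Type*} [NormedAddCommGroup H] [InnerProductSpace ℝ H]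
  {𝓕 : Filtration ℝ≥0 m} {T : ℝ≥0} {Q : H →L[ℝ] H} {W : ℝ≥0 → Ω → H}

lemma memLp_and_moments_of_hasLaw_gaussianReal {X : Ω → ℝ} {v : ℝ≥0}
    (hX : HasLaw X (gaussianReal 0 v) P) :
    MemLp X 2 P ∧ ∫ ω, X ω ∂P = 0 ∧ ∫ ω, X ω ^ 2 ∂P = v := by
  have h0 : ∫ ω, X ω ∂P = 0 := by rw [hX.integral_eq, integral_id_gaussianReal]
  refine ⟨?_, h0, ?_⟩
  · have h : MemLp id 2 (P.map X) := by rw [hX.map_eq]; exact memLp_id_gaussianReal 2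
    exact (memLp_map_measure_iff h.1 hX.aemeasurable).1 h
  · rw [← variance_of_integral_eq_zero hX.aemeasurable h0, hX.variance_eq,
      variance_id_gaussianReal]

/-- Polarisation recovers the covariance from increment variances: for `r ≤ t`, `2 E[b r * b t] =
E[b t ^ 2] + E[b r ^ 2] - E[(b t - b r) ^ 2]`, which is `(t + r - (t - r)) ⟪h, Q h⟫`. -/
lemma IsQWienerProcess.isBrownianL2_inner [CompleteSpace H]
    (hW : IsQWienerProcess 𝓕 P T Q W) {h : H} (hQ : 0 ≤ ⟪h, Q h⟫) : IsBrownianL2 P T ⟪h, Q h⟫ fun t ω => ⟪h, W t ω⟫ := by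
  have hinc : ∀ r t : ℝ≥0, r ≤ t → t ≤ T → MemLp (fun ω => ⟪h, W t ω - W r ω⟫) 2 P ∧
      ∫ ω, ⟪h, W t ω - W r ω⟫ ∂P = 0 ∧
      ∫ ω, ⟪h, W t ω - W r ω⟫ ^ 2 ∂P = ((t : ℝ) - r) * ⟪h, Q h⟫ := by
    intro r t hrt ht
    have hg := memLp_and_moments_of_hasLaw_gaussianReal (hW.gaussian_increments r t hrt ht h)
    rwa [Real.coe_toNNReal _ (mul_nonneg (sub_nonneg.2 (NNReal.coe_le_coe.2 hrt)) hQ)] at hg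
  have hz : ∀ t : ℝ≥0, (fun ω => ⟪h, W t ω - W 0 ω⟫) =ᵐ[P] fun ω => ⟪h, W t ω⟫ := fun t =>
    hW.zero.mono fun ω hω => by simp only [hω, sub_zero]
  have hmem : ∀ t ≤ T, MemLp (fun ω => ⟪h, W t ω⟫) 2 P := fun t ht =>
    (hinc 0 t zero_le ht).1.ae_eq (hz t)
  have hsq : ∀ t ≤ T, ∫ ω, ⟪h, W t ω⟫ ^ 2 ∂P = t * ⟪h, Q h⟫ := fun t ht => by
    have h1 : ∫ ω, ⟪h, W t ω⟫ ^ 2 ∂P = ∫ ω, ⟪h, W t ω - W 0 ω⟫ ^ 2 ∂P :=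
      integral_congr_ae ((hz t).mono fun ω hω => congrArg (· ^ 2) hω.symm)
    rw [h1, (hinc 0 t zero_le ht).2.2]
    simp
  have hcov : ∀ r t : ℝ≥0, r ≤ t → t ≤ T →
      ∫ ω, ⟪h, W r ω⟫ * ⟪h, W t ω⟫ ∂P = ⟪h, Q h⟫ * r := by
    intro r t hrt ht
    have h3 := (hinc r t hrt ht).2.2
    have hrm := hmem r (hrt.trans ht)
    have htm := hmem t ht
    have e : ∀ ω, ⟪h, W t ω - W r ω⟫ ^ 2
        = (⟪h, W t ω⟫ ^ 2 + ⟪h, W r ω⟫ ^ 2) - 2 * (⟪h, W r ω⟫ * ⟪h, W t ω⟫) := fun ω => by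
      rw [inner_sub_right]; ring
    have hprod : Integrable (fun ω => ⟪h, W r ω⟫ * ⟪h, W t ω⟫) P := hrm.integrable_mul htm
    have hadd : Integrable (fun ω => ⟪h, W t ω⟫ ^ 2 + ⟪h, W r ω⟫ ^ 2) P :=
      htm.integrable_sq.add hrm.integrable_sq
    simp_rw [e] at h3
    rw [integral_sub hadd (hprod.const_mul 2), integral_add htm.integrable_sq
      hrm.integrable_sq, integral_const_mul, hsq t ht, hsq r (hrt.trans ht)] at h3
    linarith
  refine ⟨hmem, fun t ht => ?_, fun r hr t ht => ?_⟩
  · rw [← integral_congr_ae (hz t)]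
    exact (hinc 0 t zero_le ht).2.1
  · rcases le_total r t with hrt | htr
    · rw [hcov r t hrt ht, min_eq_left (by exact_mod_cast hrt)]
    · simp_rw [mul_comm (⟪h, W r _⟫)]
      rw [hcov t r htr hr, min_eq_right (by exact_mod_cast htr)]

/-- Here `ε = μⱼ⁻¹ μⱼ`, which is `1` for `μⱼ > 0` and `0` for `μⱼ = 0` since `0⁻¹ = 0`; keeping `ε ≤
1` avoids a case split. -/
lemma IsQWienerProcess.isBrownianL2_modeBM [CompleteSpace H] (hW : IsQWienerProcess 𝓕 P T Q W)
    (e : HilbertBasis ℕ ℝ H) {μ : ℕ → ℝ} {j : ℕ} (hμ : ⟪e j, Q (e j)⟫ = μ j) (hμ0 : 0 ≤ μ j) :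
    ∃ ε ≤ 1, IsBrownianL2 P T ε (modeBM e μ W j) := by
  have hB := hW.isBrownianL2_inner (h := e j) (hμ.symm ▸ hμ0)
  rw [hμ] at hB
  refine ⟨(√(μ j))⁻¹ ^ 2 * μ j, ?_, fun t ht => (hB.memLp t ht).const_mul _, fun t ht => ?_,
    fun r hr t ht => ?_⟩
  · rw [inv_pow, Real.sq_sqrt hμ0]
    exact inv_mul_le_one
  · simp only [modeBM]
    rw [integral_const_mul, hB.mean t ht, mul_zero]
  · have h : ∀ ω, modeBM e μ W j r ω * modeBM e μ W j t ω
        = (√(μ j))⁻¹ ^ 2 * (⟪e j, W r ω⟫ * ⟪e j, W t ω⟫) := fun ω => by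
      simp only [modeBM]; ring
    simp_rw [h]
    rw [integral_const_mul, hB.cov r hr t ht]
    ring

lemma IsQWienerProcess.stronglyMeasurable_modeBM (hW : IsQWienerProcess 𝓕 P T Q W)
    (e : HilbertBasis ℕ ℝ H) (μ : ℕ → ℝ) (j : ℕ) {r t : ℝ≥0} (hrt : r ≤ t) (ht : t ≤ T) :
    StronglyMeasurable[𝓕 t] (modeBM e μ W j r) := by
  have h : StronglyMeasurable[𝓕 t] (W r) := (hW.adapted r (hrt.trans ht)).mono (𝓕.mono hrt)
  exact ((continuous_const.inner continuous_id).comp_stronglyMeasurable h).const_mul _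

end Modes

/-! ### Random series along an orthonormal basis -/

section Series

variable {Ω : Type*} {m : MeasurableSpace Ω} {P : Measure Ω}
  {H : Type*} [NormedAddCommGroup H] [InnerProductSpace ℝ H] [CompleteSpace H]

/-- A series along an orthonormal basis with random coefficients whose second moments are
dominated by a summable sequence converges in `L²(Ω, H)`. -/
lemma exists_tendsto_series (e : HilbertBasis ℕ ℝ H) {x : ℕ → Ω → ℝ}
    (hx : ∀ j, MemLp (x j) 2 P) {b : ℕ → ℝ} (hb : Summable b)
    (hxb : ∀ j, ∫ ω, x j ω ^ 2 ∂P ≤ b j) :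
    (∀ n, MemLp (fun ω => ∑ j ∈ Finset.range n, x j ω • e j) 2 P) ∧
      ∃ Z : Lp H 2 P, Tendsto (fun n => eLpNorm
          (fun ω => (∑ j ∈ Finset.range n, x j ω • e j) - Z ω) 2 P) atTop (𝓝 0) ∧
        ‖Z‖ ^ 2 ≤ ∑' j, b j := by
  have hterm : ∀ j, MemLp (fun ω => x j ω • e j) 2 P := fun j =>
    ((ContinuousLinearMap.id ℝ ℝ).smulRight (e j)).comp_memLp' (hx j)
  have hpart : ∀ n, MemLp (fun ω => ∑ j ∈ Finset.range n, x j ω • e j) 2 P := fun n =>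
    memLp_finsetSum _ fun j _ => hterm j
  have hsq : ∀ j, ‖(hterm j).toLp‖ ^ 2 ≤ b j := fun j => by
    rw [norm_toLp_sq]
    simpa [norm_smul, e.orthonormal.1 j] using hxb j
  have hpos : ∀ j, 0 ≤ b j := fun j => (sq_nonneg _).trans (hsq j)
  -- Orthogonality already holds pointwise in `ω`, since `⟪e i, e j⟫ = 0`.
  obtain ⟨hsum, hnorm⟩ := orthogonal_summable (u := fun j => (hterm j).toLp)
    (fun i j hij => by
      change ⟪(hterm i).toLp, (hterm j).toLp⟫ = 0
      rw [inner_toLp]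
      simp [inner_smul_left, inner_smul_right, e.orthonormal.2 hij])
    (hb.of_nonneg_of_le (fun _ => sq_nonneg _) hsq)
  set Z := ∑' j, (hterm j).toLp
  have hlim : Tendsto (fun n => ∑ j ∈ Finset.range n, (hterm j).toLp) atTop (𝓝 Z) :=
    hsum.hasSum.tendsto_sum_nat
  have hpartLp : ∀ n, (hpart n).toLp = ∑ j ∈ Finset.range n, (hterm j).toLp := by
    intro n
    refine Lp.ext ?_
    have h1 : ∀ᵐ ω ∂P, ∀ j, (hterm j).toLp _ ω = x j ω • e j :=
      ae_all_iff.2 fun j => (hterm j).coeFn_toLp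
    filter_upwards [(hpart n).coeFn_toLp, h1,
      Lp.coeFn_finsetSum (Finset.range n) fun j => (hterm j).toLp] with ω h2 h3 h4
    rw [h2, h4, Finset.sum_apply]
    simp only [h3]
  have hconv : Tendsto (fun n => eLpNorm
      (fun ω => (∑ j ∈ Finset.range n, x j ω • e j) - Z ω) 2 P) atTop (𝓝 0) := by
    refine (Lp.tendsto_Lp_iff_tendsto_eLpNorm''
      (fun n ω => ∑ j ∈ Finset.range n, x j ω • e j) hpart Z (Lp.memLp Z)).1 ?_
    rw [Lp.toLp_coeFn]
    exact hlim.congr fun n => (hpartLp n).symm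
  have h1 : ‖Z‖ ^ 2 ≤ ∑' j, b j := by
    refine le_of_tendsto (hlim.norm.pow 2) (Eventually.of_forall fun n => ?_)
    rw [hnorm]
    exact (Finset.sum_le_sum fun j _ => hsq j).trans (hb.sum_le_tsum _ fun j _ => hpos j)
  exact ⟨hpart, Z, hconv, h1⟩

/-- If random coefficients are measurable, up to null sets, with respect to a σ-algebra, then so
is the limit in `L²(Ω, H)` of the series with these coefficients. -/
lemma aestronglyMeasurable_series {m' : MeasurableSpace Ω} (hm : m' ≤ m) {x : ℕ → Ω → ℝ}
    (e : ℕ → H) (hmeas : ∀ j, AEStronglyMeasurable[m'] (x j) P) {Z : Ω → H}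
    (hpart : ∀ n, MemLp (fun ω => ∑ j ∈ Finset.range n, x j ω • e j) 2 P) (hZ : MemLp Z 2 P)
    (hlim : Tendsto (fun n => eLpNorm
      (fun ω => (∑ j ∈ Finset.range n, x j ω • e j) - Z ω) 2 P) atTop (𝓝 0)) :
    AEStronglyMeasurable[m'] Z P := by
  refine aestronglyMeasurable_of_tendsto_eLpNorm hm hpart hZ hlim fun n => ?_
  refine ⟨fun ω => ∑ j ∈ Finset.range n, (hmeas j).mk _ ω • e j,
    Finset.stronglyMeasurable_fun_sum _ fun j _ =>
      (hmeas j).stronglyMeasurable_mk.smul_const (e j), ?_⟩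
  filter_upwards [ae_all_iff.2 fun j => (hmeas j).ae_eq_mk] with ω hω
  exact Finset.sum_congr rfl fun j _ => by rw [← hω j]

end Series

end FracSPDE

theorem mainTheorem12
    -- the bounded domain and the space `L²(D)`
    (D : Set ℝ) (hD_open : IsOpen D) (hD_conn : IsConnected D) (hD_bdd : Bornology.IsBounded D)
    -- the operator, its eigenbasis and eigenvalues
    (A : Lp ℝ 2 (volume.restrict D) →ₗ.[ℝ] Lp ℝ 2 (volume.restrict D))
    (hA : IsPositiveWithCompactInverse A)
    (e : HilbertBasis ℕ ℝ (Lp ℝ 2 (volume.restrict D)))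
    (lam : ℕ → ℝ) (he : ∀ j, IsEigenpair A (lam j) (e j))
    (hlam_mono : Monotone lam)
    (α : ℝ) (hα : 0 < α) (hα_lam : α < lam 0)
    -- the covariance operator
    (Q : Lp ℝ 2 (volume.restrict D) →L[ℝ] Lp ℝ 2 (volume.restrict D)) (hQ : Q.IsPositive)
    (μ : ℕ → ℝ) (hμ : ∀ j, Q (e j) = μ j • e j)
    (hTr : Summable fun j => ⟪e j, Q (e j)⟫)
    -- the stochastic basis and the `Q`-Wiener process
    {Ω : Type*} {mΩ : MeasurableSpace Ω} (P : Measure Ω) [IsProbabilityMeasure P]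
    (T : ℝ≥0) (𝓕 : Filtration ℝ≥0 mΩ) (h𝓕 : IsNormalFiltration 𝓕 P T)
    (W : ℝ≥0 → Ω → Lp ℝ 2 (volume.restrict D)) (hW : IsQWienerProcess 𝓕 P T Q W)
    -- the exponent and the deterministic initial datum
    (s : ℝ) (hs : 0 < s) (y₀ : Lp ℝ 2 (volume.restrict D)) :
    -- the Ornstein–Uhlenbeck coefficients exist
    (∃ y : ℕ → ℝ≥0 → Ω → ℝ, ∀ j,
      IsOrnsteinUhlenbeck P T (modeBM e μ W j) ⟪e j, y₀⟫ (lam j ^ s) (√(μ j)) (y j)) ∧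
    -- and for all versions of them the series converges to an adapted, bounded process
    ∀ y : ℕ → ℝ≥0 → Ω → ℝ,
      (∀ j, IsOrnsteinUhlenbeck P T (modeBM e μ W j) ⟪e j, y₀⟫ (lam j ^ s) (√(μ j)) (y j)) →
      ∃ Y : ℝ≥0 → Ω → Lp ℝ 2 (volume.restrict D), ∀ t, t ≤ T →
        (∀ n, MemLp (fun ω => ∑ j ∈ Finset.range n, y j t ω • e j) 2 P) ∧
        MemLp (Y t) 2 P ∧
        Tendsto (fun n => eLpNorm (fun ω => (∑ j ∈ Finset.range n, y j t ω • e j) - Y t ω) 2 P)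
          atTop (𝓝 0) ∧
        StronglyMeasurable[𝓕 t] (Y t) ∧
        ∫ ω, ‖Y t ω‖ ^ 2 ∂P ≤ ‖y₀‖ ^ 2 + opTrace e Q / (2 * α ^ s) := by
  have hnormj : ∀ j, ⟪e j, e j⟫ = 1 := fun j => by
    rw [real_inner_self_eq_norm_sq, e.orthonormal.1 j, one_pow]
  have hμQ : ∀ j, ⟪e j, Q (e j)⟫ = μ j := fun j => by
    rw [hμ, inner_smul_right, hnormj, mul_one]
  have hμ0 : ∀ j, 0 ≤ μ j := fun j => hμQ j ▸ hQ.inner_nonneg_right (e j)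
  have hαs : 0 < α ^ s := Real.rpow_pos_of_pos hα s
  have hle : ∀ j, α ^ s ≤ lam j ^ s := fun j =>
    Real.rpow_le_rpow hα.le (hα_lam.le.trans (hlam_mono (Nat.zero_le j))) hs.le
  have hκ : ∀ j, 0 < lam j ^ s := fun j => hαs.trans_le (hle j)
  choose ε hε hB using fun j => hW.isBrownianL2_modeBM e (hμQ j) (hμ0 j)
  constructor
  · choose y hy using fun j => (hB j).exists_isOrnsteinUhlenbeck (c := ⟪e j, y₀⟫)
      (σ := √(μ j)) (hκ j).le
    exact ⟨y, hy⟩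
  intro y hy
  have hparseval : HasSum (fun j => ⟪e j, y₀⟫ ^ 2) (‖y₀‖ ^ 2) := by
    have h := e.hasSum_inner_mul_inner y₀ y₀
    rw [real_inner_self_eq_norm_sq] at h
    refine h.congr_fun fun j => ?_
    rw [real_inner_comm, sq]
  have hbsum : HasSum (fun j => ⟪e j, y₀⟫ ^ 2 + ⟪e j, Q (e j)⟫ / (2 * α ^ s))
      (‖y₀‖ ^ 2 + opTrace e Q / (2 * α ^ s)) :=
    hparseval.add (hTr.hasSum.div_const _)
  -- Each time is treated separately: what is claimed about `Y` concerns one `t` at a time, so the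
  -- process is assembled by choice.
  have key : ∀ t : ℝ≥0, t ≤ T → ∃ Y : Ω → Lp ℝ 2 (volume.restrict D),
      (∀ n, MemLp (fun ω => ∑ j ∈ Finset.range n, y j t ω • e j) 2 P) ∧
      MemLp Y 2 P ∧
      Tendsto (fun n => eLpNorm (fun ω => (∑ j ∈ Finset.range n, y j t ω • e j) - Y ω) 2 P)
        atTop (𝓝 0) ∧
      StronglyMeasurable[𝓕 t] Y ∧
      ∫ ω, ‖Y ω‖ ^ 2 ∂P ≤ ‖y₀‖ ^ 2 + opTrace e Q / (2 * α ^ s) := by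
    intro t ht
    have hmom := fun j => (hB j).isOrnsteinUhlenbeck_moments (hε j) (hκ j) (hy j) ht
    have hmeas := fun j => (hB j).aestronglyMeasurable_isOrnsteinUhlenbeck (hy j) ht (𝓕.le t)
      fun r hr => hW.stronglyMeasurable_modeBM e μ j hr ht
    obtain ⟨hpart, Z, hlim, hZ⟩ := exists_tendsto_series e (fun j => (hmom j).1)
      hbsum.summable fun j => (hmom j).2.trans (by
        rw [Real.sq_sqrt (hμ0 j), hμQ]
        have h0 := hμ0 j
        have h1 := hle j
        gcongr)
    -- The `L²` class `Z` is replaced by an `𝓕 t`-strongly measurable representative; convergence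
    -- and norm are unaffected.
    obtain ⟨Y, hYm, hZY⟩ :=
      aestronglyMeasurable_series (𝓕.le t) e hmeas hpart (Lp.memLp Z) hlim
    refine ⟨Y, hpart, (Lp.memLp Z).ae_eq hZY, hlim.congr fun n => eLpNorm_congr_ae ?_, hYm, ?_⟩
    · filter_upwards [hZY] with ω hω
      rw [hω]
    · rw [integral_norm_sq_of_ae_eq_Lp Z hZY, ← hbsum.tsum_eq]
      exact hZ
  choose! Y hY using key
  exact ⟨Y, hY⟩
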